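/- Let $X_0$ be a complete Hausdorff locally convex space over $\mathbb{C}$ and let $T_0=(T_0(t))_{t\ge 0}$ be a strongly continuous semigroup of continuous linear operators on $X_0$ that is exponentially equicontinuous, i.e. $\{e^{\omega t}T_0(t) : t\ge 0\}$ is equicontinuous for some $\omega\in\mathbb{R}$. The generator of such a semigroup $T$ is $Ax=\lim_{t\searrow 0}\frac{T(t)x-x}{t}$ on the set $D(A)$ of all $x$ for which this limit exists. Assume that the generator $A_0\colon D(A_0)\to X_0$ of $T_0$ is bijective and that $A_0^{-1}\colon X_0\to X_0$ is continuous. The Sobolev tower $(X_n,T_n,A_n)_{n\in\mathbb{Z}}$ is defined inductively. For $n\ge 1$, $X_n=D(A_{n-1})$ with the topology given by the seminorms $p(A_{n-1}\,\cdot)$, where $p$ runs through the continuous seminorms of $X_{n-1}$, and $T_n(t)$ is the restriction of $T_{n-1}(t)$ to $X_n$. For $n\le -1$, $X_n$ is the completion of $X_{n+1}$ with respect to the topology given by the seminorms $p(A_{n+1}^{-1}\,\cdot)$, where $p$ runs through the continuous seminorms of $X_{n+1}$, and $T_n(t)$ is the continuous extension of $T_{n+1}(t)$. In each case $A_n$ is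 the generator of $T_n$. One has $X_{n+1}=D(A_n)\subseteq X_n$ for every $n\in\mathbb{Z}$. Let $X=\bigcup_{n\in\mathbb{Z}}X_n$ carry the finest locally convex topology for which all inclusions $X_n\to X$ are continuous, and assume that this topology is Hausdorff. Let $X_{-\infty}$ be the completion of $X$. The maps $T_n(t)$, $A_n\colon X_{n+1}\to X_n$ and $A_n^{-1}\colon X_n\to X_{n+1}$ ($n\in\mathbb{Z}$) induce continuous linear maps $T(t)$, $A$ and $A^{-1}$ from $X$ to $X$; let $T_{-\infty}(t)$ and $A_{-\infty}$ be the continuous extensions of $T(t)$ and $A$ to $X_{-\infty}$. Then: (i) $T_{-\infty}=(T_{-\infty}(t))_{t\ge 0}$ is a strongly continuous and exponentially equicontinuous semigroup on $X_{-\infty}$. Its generator $(G,D(G))$ satisfies $X\subseteq D(G)\subseteq X_{-\infty}$ and $A_{-\infty}|_{D(G)}=G$. In particular, $G\colon D(G)\to X_{-\infty}$ is continuous for the topology induced by $X_{-\infty}$ on $D(G)$. (ii) If $X_{-\infty}$ is barrelled, then $D(G)=X_{-\infty}$ and consequently $G=A_{-\infty}$. (iii) $A_{-\infty}\colon X_{-\infty}\to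 X_{-\infty}$ is a topological isomorphism. Its inverse $A_{-\infty}^{-1}$ is the unique continuous extension to $X_{-\infty}$ of the map $A^{-1}\colon X\to X$ induced by the inverses $A_n^{-1}\colon X_n\to X_{n+1}$. -/

import Mathlib

open Filter Topology UniformSpace
open scoped NNReal

universe u

section Semigroups

/-- `T` is a strongly continuous, exponentially equicontinuous one-parameter semigroup of
continuous linear operators on `E`. -/
structure IsExpEquicontSemigroup {E : Type u} [AddCommGroup E] [Module ℂ E] [UniformSpace E]
    (T : ℝ≥0 → E →L[ℂ] E) : Prop where
  map_zero : T 0 = ContinuousLinearMap.id ℂ E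
  map_add : ∀ t s : ℝ≥0, T (t + s) = (T t).comp (T s)
  strongly_continuous : ∀ x : E, Continuous fun t : ℝ≥0 => T t x
  exp_equicontinuous : ∃ ω : ℝ,
    Equicontinuous fun (t : ℝ≥0) (x : E) => ((Real.exp (ω * t) : ℝ) : ℂ) • T t x

/-- `(T(t)x - x)/t` converges to `y` as `t ↘ 0`. -/
def HasGeneratorValue {E : Type u} [AddCommGroup E] [Module ℂ E] [TopologicalSpace E]
    (T : ℝ≥0 → E →L[ℂ] E) (x y : E) : Prop :=
  Tendsto (fun t : ℝ≥0 => (((t : ℝ) : ℂ)⁻¹) • (T t x - x)) (𝓝[>] 0) (𝓝 y)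

theorem HasGeneratorValue.unique {E : Type u} [AddCommGroup E] [Module ℂ E] [TopologicalSpace E]
    [T2Space E] {T : ℝ≥0 → E →L[ℂ] E} {x y z : E}
    (hy : HasGeneratorValue T x y) (hz : HasGeneratorValue T x z) : y = z :=
  tendsto_nhds_unique hy hz

theorem HasGeneratorValue.map {E F : Type u} [AddCommGroup E] [Module ℂ E] [TopologicalSpace E]
    [AddCommGroup F] [Module ℂ F] [TopologicalSpace F]
    {T : ℝ≥0 → E →L[ℂ] E} {S : ℝ≥0 → F →L[ℂ] F} (J : E →L[ℂ] F)
    (hJ : ∀ t x, J (T t x) = S t (J x)) {x y : E} (h : HasGeneratorValue T x y) :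
    HasGeneratorValue S (J x) (J y) := by
  have := (J.continuous.tendsto y).comp h
  refine this.congr fun t => ?_
  simp [map_smul, map_sub, hJ]

/-- The generator of `T`: its domain is the set of those `x` for which the limit of
`(T(t)x - x)/t` for `t ↘ 0` exists, and its value at `x` is this limit. -/
noncomputable def generator {E : Type u} [AddCommGroup E] [Module ℂ E] [TopologicalSpace E]
    [IsTopologicalAddGroup E] [ContinuousConstSMul ℂ E] [T2Space E]
    (T : ℝ≥0 → E →L[ℂ] E) : E →ₗ.[ℂ] E where
  domain :=
    { carrier := {x | ∃ y, HasGeneratorValue T x y}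
      add_mem' := by
        rintro a b ⟨y, hy⟩ ⟨z, hz⟩
        refine ⟨y + z, (Tendsto.add hy hz).congr fun t => ?_⟩
        rw [map_add, ← smul_add]
        congr 1
        abel
      zero_mem' := ⟨0, by simp [HasGeneratorValue]⟩
      smul_mem' := by
        rintro c a ⟨y, hy⟩
        refine ⟨c • y, (Tendsto.const_smul hy c).congr fun t => ?_⟩
        rw [map_smul, ← smul_sub, smul_comm] }
  toFun :=
    { toFun := fun x => x.2.choose
      map_add' := by
        intro a b
        refine HasGeneratorValue.unique (a + b).2.choose_spec
          ((Tendsto.add a.2.choose_spec b.2.choose_spec).congr fun t => ?_)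
        rw [Submodule.coe_add, map_add, ← smul_add]
        congr 1
        abel
      map_smul' := by
        intro c a
        refine HasGeneratorValue.unique (c • a).2.choose_spec
          ((Tendsto.const_smul a.2.choose_spec c).congr fun t => ?_)
        rw [Submodule.coe_smul, map_smul, ← smul_sub, smul_comm] }

section GeneratorLemmas

variable {E : Type u} [AddCommGroup E] [Module ℂ E] [TopologicalSpace E]
    [IsTopologicalAddGroup E] [ContinuousConstSMul ℂ E] [T2Space E]
    {T : ℝ≥0 → E →L[ℂ] E}

theorem mem_generator_domain {x : E} :
    x ∈ (generator T).domain ↔ ∃ y, HasGeneratorValue T x y := Iff.rfl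

theorem generator_spec (x : (generator T).domain) :
    HasGeneratorValue T x (generator T x) := x.2.choose_spec

theorem generator_eq {x : (generator T).domain} {y : E} (h : HasGeneratorValue T x y) :
    generator T x = y := (generator_spec x).unique h

end GeneratorLemmas

end Semigroups

/-- A complete Hausdorff locally convex space over `ℂ` together with a strongly continuous,
exponentially equicontinuous semigroup `T` on it, whose generator `A : D(A) → E` is bijective
with continuous inverse `A⁻¹ : E → E`. -/
structure InvertibleSemigroup : Type (u + 1) where
  carrier : Type u
  [addCommGroup : AddCommGroup carrier]
  [module : Module ℂ carrier]
  [uniformSpace : UniformSpace carrier]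
  [isUniformAddGroup : IsUniformAddGroup carrier]
  [continuousSMul : ContinuousSMul ℂ carrier]
  [locallyConvexSpace : LocallyConvexSpace ℝ carrier]
  [t2Space : T2Space carrier]
  [completeSpace : CompleteSpace carrier]
  T : ℝ≥0 → carrier →L[ℂ] carrier
  isSemigroup : IsExpEquicontSemigroup T
  bijective : Function.Bijective (fun x : (generator T).domain => generator T x)
  continuous_inverse :
    Continuous fun y : carrier => ((Equiv.ofBijective _ bijective).symm y : carrier)

attribute [instance] InvertibleSemigroup.addCommGroup InvertibleSemigroup.module
  InvertibleSemigroup.uniformSpace InvertibleSemigroup.isUniformAddGroup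
  InvertibleSemigroup.continuousSMul InvertibleSemigroup.locallyConvexSpace
  InvertibleSemigroup.t2Space InvertibleSemigroup.completeSpace

namespace InvertibleSemigroup

instance (P : InvertibleSemigroup.{u}) : UniformContinuousConstSMul ℂ P.carrier :=
  uniformContinuousConstSMul_of_continuousConstSMul ℂ P.carrier

section Inverse

variable (P : InvertibleSemigroup.{u})

/-- The generator as a linear isomorphism from its domain. -/
noncomputable def genEquiv : (generator P.T).domain ≃ₗ[ℂ] P.carrier :=
  LinearEquiv.ofBijective (generator P.T).toFun P.bijective

/-- The inverse `A⁻¹` of the generator, as a continuous operator on the whole space. -/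
noncomputable def inv : P.carrier →L[ℂ] P.carrier where
  toLinearMap := (generator P.T).domain.subtype ∘ₗ P.genEquiv.symm.toLinearMap
  cont := by
    refine P.continuous_inverse.congr fun y => ?_
    exact congrArg Subtype.val (Equiv.symm_apply_eq _ |>.2 (P.genEquiv.apply_symm_apply y).symm)

theorem inv_spec (y : P.carrier) : HasGeneratorValue P.T (P.inv y) y := by
  have h := generator_spec (P.genEquiv.symm y)
  have h2 : generator P.T (P.genEquiv.symm y) = y := P.genEquiv.apply_symm_apply y
  rw [h2] at h
  exact h

theorem inv_eq {x y : P.carrier} (h : HasGeneratorValue P.T x y) : P.inv y = x := by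
  have h1 : P.genEquiv ⟨x, y, h⟩ = y := generator_eq h
  have h2 : P.genEquiv.symm y = ⟨x, y, h⟩ :=
    (P.genEquiv.symm_apply_eq (x := y) (y := ⟨x, y, h⟩)).2 h1.symm
  change ((P.genEquiv.symm y : (generator P.T).domain) : P.carrier) = x
  rw [h2]

theorem inv_injective : Function.Injective P.inv := fun x y h => by
  have h1 := P.inv_spec x
  rw [h] at h1
  exact h1.unique (P.inv_spec y)

theorem T_comm (s t : ℝ≥0) (x : P.carrier) : P.T s (P.T t x) = P.T t (P.T s x) := by
  have h1 := congrArg (fun f => f x) (P.isSemigroup.map_add s t)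
  have h2 := congrArg (fun f => f x) (P.isSemigroup.map_add t s)
  rw [add_comm] at h1
  exact h1.symm.trans h2

theorem inv_T (t : ℝ≥0) (x : P.carrier) : P.inv (P.T t x) = P.T t (P.inv x) :=
  P.inv_eq ((P.inv_spec x).map (P.T t) fun s x => P.T_comm t s x)

theorem denseRange_inv : DenseRange P.inv := by
  intro y
  refine mem_closure_of_tendsto (P.inv_spec y) (Eventually.of_forall fun t => ?_)
  exact ⟨((t : ℝ) : ℂ)⁻¹ • (P.T t y - y), by rw [map_smul, map_sub, inv_T]⟩

end Inverse

section Transfer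

/-- A semigroup that is similar to `P.T` through a linear uniform isomorphism `J`. -/
noncomputable def transfer (P : InvertibleSemigroup.{u}) (F : Type u) [AddCommGroup F]
    [Module ℂ F] [UniformSpace F] [IsUniformAddGroup F] [T2Space F]
    (J : F ≃ₗ[ℂ] P.carrier) (hJ : IsUniformInducing J) (S : ℝ≥0 → F →L[ℂ] F)
    (hS : ∀ t x, J (S t x) = P.T t (J x)) : InvertibleSemigroup.{u} :=
  have hcont : Continuous J := hJ.uniformContinuous.continuous
  have hcs : Continuous J.symm := by
    rw [hJ.isInducing.continuous_iff]
    convert continuous_id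
    ext x
    simp
  let Jc : F →L[ℂ] P.carrier := ⟨J.toLinearMap, hcont⟩
  let Js : P.carrier →L[ℂ] F := ⟨J.symm.toLinearMap, hcs⟩
  have hS' : ∀ t x, Js (P.T t x) = S t (Js x) := fun t x => by
    apply J.injective
    change J (J.symm _) = J (S t (J.symm x))
    rw [hS, J.apply_symm_apply, J.apply_symm_apply]
  haveI : ContinuousSMul ℂ F := by
    have := continuousSMul_induced (R := ℂ) J
    rwa [← hJ.isInducing.eq_induced] at this
  haveI : LocallyConvexSpace ℝ F := by
    have := LocallyConvexSpace.induced (J.toLinearMap.restrictScalars ℝ)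
    change @LocallyConvexSpace ℝ F _ _ _ _ (TopologicalSpace.induced J inferInstance) at this
    rwa [← hJ.isInducing.eq_induced] at this
  haveI : CompleteSpace F := (hJ.completeSpace_congr J.surjective).2 inferInstance
  have hgen : ∀ x y, HasGeneratorValue S x y ↔ HasGeneratorValue P.T (J x) (J y) := fun x y =>
    ⟨fun h => h.map Jc hS, fun h => by
      have := h.map Js hS'
      change HasGeneratorValue S (J.symm (J x)) (J.symm (J y)) at this
      simpa using this⟩
  have hbij : Function.Bijective (fun x : (generator S).domain => generator S x) := by
    constructor
    · intro a b hab
      have ha := (hgen _ _).1 (generator_spec a)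
      have hb := (hgen _ _).1 (generator_spec b)
      change generator S a = generator S b at hab
      rw [hab] at ha
      exact Subtype.ext (J.injective ((P.inv_eq ha).symm.trans (P.inv_eq hb)))
    · intro y
      have h : HasGeneratorValue S (J.symm (P.inv (J y))) y := by
        rw [hgen, J.apply_symm_apply]
        exact P.inv_spec _
      exact ⟨⟨_, y, h⟩, generator_eq h⟩
  { carrier := F
    T := S
    isSemigroup :=
      { map_zero := by
          ext x
          apply J.injective
          rw [hS, P.isSemigroup.map_zero]
          rfl
        map_add := fun t s => by
          ext x
          apply J.injective
          rw [hS, P.isSemigroup.map_add, ContinuousLinearMap.comp_apply,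
            ContinuousLinearMap.comp_apply, hS, hS]
        strongly_continuous := fun x => by
          rw [hJ.isInducing.continuous_iff]
          exact (P.isSemigroup.strongly_continuous (J x)).congr fun t => (hS t x).symm
        exp_equicontinuous := by
          obtain ⟨ω, hω⟩ := P.isSemigroup.exp_equicontinuous
          refine ⟨ω, hJ.equicontinuous_iff.2 fun x => ?_⟩
          have h := fun U hU => (hcont.tendsto x).eventually (hω (J x) U hU)
          intro U hU
          refine (h U hU).mono fun z hz t => ?_
          simpa [hS] using hz t }
    bijective := hbij
    continuous_inverse := by
      have key : ∀ y : F, (((Equiv.ofBijective _ hbij).symm y : (generator S).domain) : F)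
          = J.symm (P.inv (J y)) := fun y => by
        have h : HasGeneratorValue S (J.symm (P.inv (J y))) y := by
          rw [hgen, J.apply_symm_apply]
          exact P.inv_spec _
        have h2 : (Equiv.ofBijective _ hbij) ⟨_, y, h⟩ = y := generator_eq h
        have h3 : (Equiv.ofBijective _ hbij).symm y = ⟨_, y, h⟩ := by
          rw [Equiv.symm_apply_eq]
          exact h2.symm
        rw [h3]
      simp_rw [key]
      exact hcs.comp (P.inv.continuous.comp hcont) }

end Transfer

section Lower

variable (P : InvertibleSemigroup.{u})

/-- The domain `D(A)`, with the topology given by the seminorms `p(A ·)`, where `p` runs through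
the continuous seminorms of the space. -/
def Lower : Type u := (generator P.T).domain

noncomputable instance : AddCommGroup P.Lower :=
  inferInstanceAs (AddCommGroup (generator P.T).domain)

noncomputable instance : Module ℂ P.Lower :=
  inferInstanceAs (Module ℂ (generator P.T).domain)

/-- The generator `A : D(A) → E`. -/
noncomputable def lowerA : P.Lower ≃ₗ[ℂ] P.carrier := P.genEquiv

noncomputable instance : UniformSpace P.Lower := UniformSpace.comap P.lowerA inferInstance

instance : IsUniformAddGroup P.Lower := IsUniformAddGroup.comap P.lowerA

theorem lowerA_inducing : IsUniformInducing P.lowerA := ⟨rfl⟩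

instance : T2Space P.Lower :=
  T2Space.of_injective_continuous P.lowerA.injective P.lowerA_inducing.uniformContinuous.continuous

/-- The inclusion `D(A) → E`. -/
noncomputable def lowerIncl : P.Lower →ₗ[ℂ] P.carrier := (generator P.T).domain.subtype

theorem lowerIncl_eq (x : P.Lower) : P.lowerIncl x = P.inv (P.lowerA x) := by
  refine (P.inv_eq ?_).symm
  exact generator_spec (T := P.T) x

/-- The restriction of `T(t)` to `D(A)`. -/
noncomputable def lowerT (t : ℝ≥0) : P.Lower →L[ℂ] P.Lower where
  toLinearMap := LinearMap.restrict (p := (generator P.T).domain) (q := (generator P.T).domain)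
    (P.T t).toLinearMap fun _ hx =>
      ⟨_, hx.choose_spec.map (P.T t) fun s x => P.T_comm t s x⟩
  cont := by
    rw [P.lowerA_inducing.isInducing.continuous_iff]
    refine ((P.T t).continuous.comp P.lowerA_inducing.uniformContinuous.continuous).congr
      fun x => ?_
    symm
    exact generator_eq ((generator_spec (T := P.T) x).map (P.T t) fun s x => P.T_comm t s x)

theorem lowerIncl_lowerT (t : ℝ≥0) (x : P.Lower) :
    P.lowerIncl (P.lowerT t x) = P.T t (P.lowerIncl x) := rfl

theorem lowerA_lowerT (t : ℝ≥0) (x : P.Lower) :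
    P.lowerA (P.lowerT t x) = P.T t (P.lowerA x) :=
  generator_eq ((generator_spec (T := P.T) x).map (P.T t) fun s x => P.T_comm t s x)

/-- The next lower step of the tower: `D(A)` with the topology given by the seminorms `p(A ·)`
and with the restricted semigroup. -/
noncomputable def lower : InvertibleSemigroup.{u} :=
  P.transfer P.Lower P.lowerA P.lowerA_inducing P.lowerT P.lowerA_lowerT

end Lower

section Upper

variable (P : InvertibleSemigroup.{u})

/-- The space itself, with the topology given by the seminorms `p(A⁻¹ ·)`, where `p` runs through
the continuous seminorms of the space. -/
def PreUpper : Type u := P.carrier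

noncomputable instance : AddCommGroup P.PreUpper := inferInstanceAs (AddCommGroup P.carrier)

noncomputable instance : Module ℂ P.PreUpper := inferInstanceAs (Module ℂ P.carrier)

/-- `A⁻¹`, as a map on the space with the topology of the seminorms `p(A⁻¹ ·)`. -/
noncomputable def preInv : P.PreUpper →ₗ[ℂ] P.carrier := P.inv.toLinearMap

noncomputable instance : UniformSpace P.PreUpper := UniformSpace.comap P.preInv inferInstance

instance : IsUniformAddGroup P.PreUpper := IsUniformAddGroup.comap P.preInv

theorem preInv_inducing : IsUniformInducing P.preInv := ⟨rfl⟩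

instance : ContinuousSMul ℂ P.PreUpper := continuousSMul_induced P.preInv

instance : UniformContinuousConstSMul ℂ P.PreUpper :=
  uniformContinuousConstSMul_of_continuousConstSMul ℂ P.PreUpper

/-- `T(t)` as a continuous operator for the topology of the seminorms `p(A⁻¹ ·)`. -/
noncomputable def preT (t : ℝ≥0) : P.PreUpper →L[ℂ] P.PreUpper where
  toLinearMap := (P.T t).toLinearMap
  cont := by
    rw [P.preInv_inducing.isInducing.continuous_iff]
    refine ((P.T t).continuous.comp P.preInv_inducing.uniformContinuous.continuous).congr
      fun x => ?_
    exact (P.inv_T t x).symm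

/-- The completion of the space with respect to the topology of the seminorms `p(A⁻¹ ·)`. -/
abbrev Upper : Type u := Completion P.PreUpper

/-- The continuous extension of `T(t)` to the completion. -/
noncomputable def upperT (t : ℝ≥0) : P.Upper →L[ℂ] P.Upper := (P.preT t).completion

/-- The canonical map of the space into the completion. -/
noncomputable def upperIncl : P.carrier →ₗ[ℂ] P.Upper where
  toFun x := ((show P.PreUpper from x) : Completion P.PreUpper)
  map_add' x y := Completion.coe_add (α := P.PreUpper) x y
  map_smul' c x := Completion.coe_smul (X := P.PreUpper) c x

/-- The continuous extension of `A⁻¹` to the completion. -/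
noncomputable def upperInvMap : P.Upper →L[ℂ] P.carrier :=
  ContinuousLinearMap.fromCompletion
    ⟨P.preInv, P.preInv_inducing.uniformContinuous.continuous⟩

theorem upperInvMap_upperIncl (x : P.carrier) : P.upperInvMap (P.upperIncl x) = P.inv x :=
  ContinuousLinearMap.fromCompletion_apply_coe
    (⟨P.preInv, P.preInv_inducing.uniformContinuous.continuous⟩ : P.PreUpper →L[ℂ] P.carrier) x

/-- The space is a completion of itself in the topology of the seminorms `p(A⁻¹ ·)`, through
`A⁻¹`. -/
noncomputable def upperPkg : AbstractCompletion.{u} P.PreUpper where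
  space := P.carrier
  coe := P.preInv
  uniformStruct := inferInstance
  complete := inferInstance
  separation := inferInstance
  isUniformInducing := P.preInv_inducing
  dense := P.denseRange_inv

theorem coe_upperInvMap :
    (P.upperInvMap : P.Upper → P.carrier) =
      (Completion.cPkg (α := P.PreUpper)).compareEquiv P.upperPkg := by
  rw [upperInvMap, ContinuousLinearMap.coe_fromCompletion]
  rfl

theorem upperInvMap_bijective : Function.Bijective P.upperInvMap := by
  rw [coe_upperInvMap]
  exact UniformEquiv.bijective _

theorem upperInvMap_inducing : IsUniformInducing P.upperInvMap := by
  rw [coe_upperInvMap]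
  exact UniformEquiv.isUniformInducing _

/-- The continuous extension of `A⁻¹` to the completion, as a bijection. -/
noncomputable def upperInv : P.Upper ≃ₗ[ℂ] P.carrier :=
  LinearEquiv.ofBijective P.upperInvMap.toLinearMap P.upperInvMap_bijective

theorem upperInv_upperT (t : ℝ≥0) (x : P.Upper) :
    P.upperInv (P.upperT t x) = P.T t (P.upperInv x) := by
  change P.upperInvMap (P.upperT t x) = P.T t (P.upperInvMap x)
  induction x using Completion.induction_on with
  | hp =>
    exact isClosed_eq (P.upperInvMap.continuous.comp (P.upperT t).continuous)
      ((P.T t).continuous.comp P.upperInvMap.continuous)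
  | ih x =>
    rw [upperT, ContinuousLinearMap.completion_apply_coe]
    exact (P.upperInvMap_upperIncl (P.T t x)).trans ((P.inv_T t x).trans
      (congrArg (P.T t) (P.upperInvMap_upperIncl x).symm))

/-- The next upper step of the tower: the completion of the space with respect to the topology
given by the seminorms `p(A⁻¹ ·)`, with the continuous extension of the semigroup. -/
noncomputable def upper : InvertibleSemigroup.{u} :=
  P.transfer P.Upper P.upperInv P.upperInvMap_inducing P.upperT P.upperInv_upperT

theorem upperIncl_T (t : ℝ≥0) (x : P.carrier) :
    P.upperIncl (P.T t x) = P.upperT t (P.upperIncl x) :=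
  ((P.preT t).completion_apply_coe x).symm

end Upper

section Tower

variable (P : InvertibleSemigroup.{u})

/-- The spaces with index `n ≥ 0` of the tower. -/
noncomputable def lowerTower : ℕ → InvertibleSemigroup.{u}
  | 0 => P
  | n + 1 => (lowerTower n).lower

/-- The spaces with index `-n ≤ 0` of the tower. -/
noncomputable def upperTower : ℕ → InvertibleSemigroup.{u}
  | 0 => P
  | n + 1 => (upperTower n).upper

/-- The Sobolev tower: the `n`-th Sobolev space `X_n`, `n ∈ ℤ`, with its semigroup `T_n`. -/
noncomputable def tower : ℤ → InvertibleSemigroup.{u}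
  | Int.ofNat n => P.lowerTower n
  | Int.negSucc n => P.upperTower (n + 1)

/-- The `n`-th Sobolev space `X_n`. -/
abbrev X (n : ℤ) : Type u := (P.tower n).carrier

/-- The inclusion `X_{n+1} → X_n`. -/
noncomputable def incl : (n : ℤ) → P.X (n + 1) →ₗ[ℂ] P.X n
  | Int.ofNat n => (P.lowerTower n).lowerIncl
  | Int.negSucc 0 => P.upperIncl
  | Int.negSucc (n + 1) => (P.upperTower (n + 1)).upperIncl

theorem exists_step_lower : ∃ B : P.lower.carrier ≃L[ℂ] P.carrier,
    (∀ x, P.lowerIncl x = P.inv (B x)) ∧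
      ∀ t x, P.lowerIncl (P.lower.T t x) = P.T t (P.lowerIncl x) := by
  refine ⟨⟨P.lowerA, P.lowerA_inducing.uniformContinuous.continuous, ?_⟩,
    P.lowerIncl_eq, fun t x => rfl⟩
  refine P.lowerA_inducing.isInducing.continuous_iff.2 ?_
  exact continuous_id.congr fun x => (P.lowerA.apply_symm_apply x).symm

theorem exists_step_upper : ∃ B : P.carrier ≃L[ℂ] P.upper.carrier,
    (∀ x, P.upperIncl x = P.upper.inv (B x)) ∧
      ∀ t x, P.upperIncl (P.T t x) = P.upper.T t (P.upperIncl x) := by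
  have hc : Continuous P.upperInv.symm := by
    refine P.upperInvMap_inducing.isInducing.continuous_iff.2 ?_
    exact continuous_id.congr fun x => (P.upperInv.apply_symm_apply x).symm
  let Js : P.carrier →L[ℂ] P.Upper := ⟨P.upperInv.symm.toLinearMap, hc⟩
  refine ⟨⟨P.upperInv.symm, hc, P.upperInvMap.continuous⟩, fun x => ?_, P.upperIncl_T⟩
  refine (P.upper.inv_eq ?_).symm
  have h := (P.inv_spec x).map (S := P.upper.T) Js fun t y => by
    apply P.upperInv.injective
    refine (P.upperInv.apply_symm_apply _).trans ?_
    refine Eq.trans ?_ (P.upperInv_upperT t _).symm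
    exact congrArg (P.T t) (P.upperInv.apply_symm_apply y).symm
  have h2 : Js (P.inv x) = P.upperIncl x :=
    P.upperInv.symm_apply_eq.2 (P.upperInvMap_upperIncl x).symm
  exact h2 ▸ h

theorem exists_step : ∀ n : ℤ, ∃ B : P.X (n + 1) ≃L[ℂ] P.X n,
    (∀ x, P.incl n x = (P.tower n).inv (B x)) ∧
      ∀ t x, P.incl n ((P.tower (n + 1)).T t x) = (P.tower n).T t (P.incl n x)
  | Int.ofNat n => (P.lowerTower n).exists_step_lower
  | Int.negSucc 0 => P.exists_step_upper
  | Int.negSucc (n + 1) => (P.upperTower (n + 1)).exists_step_upper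

theorem incl_T (n : ℤ) (t : ℝ≥0) (x : P.X (n + 1)) :
    P.incl n ((P.tower (n + 1)).T t x) = (P.tower n).T t (P.incl n x) :=
  (P.exists_step n).choose_spec.2 t x

theorem continuous_incl (n : ℤ) : Continuous (P.incl n) := by
  obtain ⟨B, hB, -⟩ := P.exists_step n
  exact ((P.tower n).inv.continuous.comp B.continuous).congr fun x => (hB x).symm

/-- `X_{n+1}` is contained in `D(A_n)`. -/
theorem incl_mem (n : ℤ) (x : P.X (n + 1)) :
    P.incl n x ∈ (generator (P.tower n).T).domain := by
  obtain ⟨B, hB, -⟩ := P.exists_step n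
  rw [hB]
  exact ⟨_, (P.tower n).inv_spec _⟩

theorem incl_injective (n : ℤ) : Function.Injective (P.incl n) := by
  obtain ⟨B, hB, -⟩ := P.exists_step n
  intro x y h
  rw [hB, hB] at h
  exact B.injective ((P.tower n).inv_injective h)

/-- `X_{n+1} = D(A_n)`. -/
theorem range_incl (n : ℤ) :
    LinearMap.range (P.incl n) = (generator (P.tower n).T).domain := by
  refine le_antisymm ?_ ?_
  · rintro _ ⟨x, rfl⟩
    exact P.incl_mem n x
  · rintro x ⟨y, hy⟩
    obtain ⟨B, hB, -⟩ := P.exists_step n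
    refine ⟨B.symm y, ?_⟩
    rw [hB, B.apply_symm_apply]
    exact (P.tower n).inv_eq hy

/-- The generator `A_n` of `T_n`, as a map `X_{n+1} → X_n`. -/
noncomputable def A (n : ℤ) : P.X (n + 1) →ₗ[ℂ] P.X n :=
  (generator (P.tower n).T).toFun ∘ₗ (P.incl n).codRestrict _ (P.incl_mem n)

theorem A_spec (n : ℤ) (x : P.X (n + 1)) :
    HasGeneratorValue (P.tower n).T (P.incl n x) (P.A n x) :=
  generator_spec (T := (P.tower n).T) ⟨P.incl n x, P.incl_mem n x⟩

theorem exists_A_eq (n : ℤ) : ∃ B : P.X (n + 1) ≃L[ℂ] P.X n, ∀ x, P.A n x = B x := by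
  obtain ⟨B, hB, -⟩ := P.exists_step n
  refine ⟨B, fun x => (P.A_spec n x).unique ?_⟩
  rw [hB]
  exact (P.tower n).inv_spec _

theorem A_bijective (n : ℤ) : Function.Bijective (P.A n) := by
  obtain ⟨B, hB⟩ := P.exists_A_eq n
  rw [show ⇑(P.A n) = B from funext hB]
  exact B.bijective

theorem continuous_A (n : ℤ) : Continuous (P.A n) := by
  obtain ⟨B, hB⟩ := P.exists_A_eq n
  exact B.continuous.congr fun x => (hB x).symm

/-- The inverse `A_n⁻¹ : X_n → X_{n+1}` of the generator of `T_n`. -/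
noncomputable def Ainv (n : ℤ) : P.X n →ₗ[ℂ] P.X (n + 1) :=
  (LinearEquiv.ofBijective (P.A n) (P.A_bijective n)).symm.toLinearMap

theorem A_Ainv (n : ℤ) (x : P.X n) : P.A n (P.Ainv n x) = x :=
  (LinearEquiv.ofBijective (P.A n) (P.A_bijective n)).apply_symm_apply x

theorem Ainv_A (n : ℤ) (x : P.X (n + 1)) : P.Ainv n (P.A n x) = x :=
  (LinearEquiv.ofBijective (P.A n) (P.A_bijective n)).symm_apply_apply x

theorem continuous_Ainv (n : ℤ) : Continuous (P.Ainv n) := by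
  obtain ⟨B, hB⟩ := P.exists_A_eq n
  refine B.symm.continuous.congr fun x => ?_
  apply (P.A_bijective n).1
  rw [A_Ainv, hB, B.apply_symm_apply]

/-- `A_n` extends `A_{n+1}`. -/
theorem incl_A (n : ℤ) (x : P.X (n + 1 + 1)) :
    P.incl n (P.A (n + 1) x) = P.A n (P.incl (n + 1) x) :=
  ((P.A_spec (n + 1) x).map ⟨P.incl n, P.continuous_incl n⟩ (P.incl_T n)).unique
    (P.A_spec n (P.incl (n + 1) x))

/-- `A_n⁻¹` extends `A_{n+1}⁻¹`. -/
theorem incl_Ainv (n : ℤ) (x : P.X (n + 1)) :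
    P.incl (n + 1) (P.Ainv (n + 1) x) = P.Ainv n (P.incl n x) := by
  apply (P.A_bijective n).1
  rw [A_Ainv, ← incl_A, A_Ainv]

end Tower

section InductiveLimit

variable (P : InvertibleSemigroup.{u})

/-- The relations that identify `x ∈ X_{n+1}` with its image in `X_n`. -/
noncomputable def limitRel : Submodule ℂ (DirectSum ℤ P.X) :=
  Submodule.span ℂ {z | ∃ (n : ℤ) (x : P.X (n + 1)),
    z = DirectSum.lof ℂ ℤ P.X (n + 1) x - DirectSum.lof ℂ ℤ P.X n (P.incl n x)}

/-- The union `X = ⋃ₙ X_n` over all `n ∈ ℤ`, as the algebraic direct limit of the chain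
`⋯ → X_{n+1} → X_n → X_{n-1} → ⋯` of inclusions. -/
def IndLimit : Type u := DirectSum ℤ P.X ⧸ P.limitRel

noncomputable instance : AddCommGroup P.IndLimit :=
  inferInstanceAs (AddCommGroup (DirectSum ℤ P.X ⧸ P.limitRel))

noncomputable instance : Module ℂ P.IndLimit :=
  inferInstanceAs (Module ℂ (DirectSum ℤ P.X ⧸ P.limitRel))

/-- The inclusion `X_n → X`. -/
noncomputable def toLimit (n : ℤ) : P.X n →ₗ[ℂ] P.IndLimit :=
  P.limitRel.mkQ ∘ₗ DirectSum.lof ℂ ℤ P.X n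

theorem toLimit_incl (n : ℤ) (x : P.X (n + 1)) :
    P.toLimit n (P.incl n x) = P.toLimit (n + 1) x := by
  symm
  exact (Submodule.Quotient.eq _).2 (Submodule.subset_span ⟨n, x, rfl⟩)

/-- The linear map on `X` induced by compatible linear maps on the `X_n`. -/
noncomputable def limitLift {F : Type u} [AddCommGroup F] [Module ℂ F]
    (f : ∀ n, P.X n →ₗ[ℂ] F) (hf : ∀ n x, f n (P.incl n x) = f (n + 1) x) :
    P.IndLimit →ₗ[ℂ] F :=
  P.limitRel.liftQ (DirectSum.toModule ℂ ℤ F f) <| by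
    refine Submodule.span_le.2 ?_
    rintro _ ⟨n, x, rfl⟩
    simp [DirectSum.toModule_lof, hf]

theorem limitLift_toLimit {F : Type u} [AddCommGroup F] [Module ℂ F]
    (f : ∀ n, P.X n →ₗ[ℂ] F) (hf : ∀ n x, f n (P.incl n x) = f (n + 1) x) (n : ℤ) (x : P.X n) :
    P.limitLift f hf (P.toLimit n x) = f n x :=
  DirectSum.toModule_lof ℂ n x

/-- The locally convex vector space topologies on `X` for which all inclusions `X_n → X` are
continuous. -/
def limitTopologies : Set (TopologicalSpace P.IndLimit) :=
  {t | @IsTopologicalAddGroup P.IndLimit t _ ∧ @ContinuousSMul ℂ P.IndLimit _ _ t ∧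
    @LocallyConvexSpace ℝ P.IndLimit _ _ _ _ t ∧
      ∀ n, @Continuous (P.X n) P.IndLimit _ t (P.toLimit n)}

/-- The inductive limit topology: the finest locally convex topology on `X` for which all
inclusions `X_n → X` are continuous. -/
abbrev limitTopology : TopologicalSpace P.IndLimit := sInf P.limitTopologies

theorem limitTopology_mem : P.limitTopology ∈ P.limitTopologies :=
  ⟨topologicalAddGroup_sInf fun _ h => h.1, continuousSMul_sInf fun _ h => h.2.1,
    LocallyConvexSpace.sInf fun _ h => h.2.2.1,
    fun n => continuous_sInf_rng.2 fun _ h => h.2.2.2 n⟩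

theorem limitTopology_isLeast : IsLeast P.limitTopologies P.limitTopology :=
  ⟨P.limitTopology_mem, fun _ h => sInf_le h⟩

noncomputable instance : UniformSpace P.IndLimit :=
  @IsTopologicalAddGroup.rightUniformSpace P.IndLimit _ P.limitTopology P.limitTopology_mem.1

instance : IsUniformAddGroup P.IndLimit :=
  @isUniformAddGroup_of_addCommGroup P.IndLimit _ P.limitTopology P.limitTopology_mem.1

instance : ContinuousSMul ℂ P.IndLimit := P.limitTopology_mem.2.1

instance : LocallyConvexSpace ℝ P.IndLimit := P.limitTopology_mem.2.2.1

instance : UniformContinuousConstSMul ℂ P.IndLimit :=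
  uniformContinuousConstSMul_of_continuousConstSMul ℂ P.IndLimit

theorem continuous_toLimit (n : ℤ) : Continuous (P.toLimit n) := P.limitTopology_mem.2.2.2 n

theorem continuous_of_comp_toLimit (f : P.IndLimit →ₗ[ℂ] P.IndLimit)
    (hf : ∀ n, Continuous fun x => f (P.toLimit n x)) : Continuous f := by
  rw [continuous_iff_le_induced]
  refine sInf_le ⟨topologicalAddGroup_induced f, continuousSMul_induced f,
    LocallyConvexSpace.induced (f.restrictScalars ℝ), fun n => ?_⟩
  exact continuous_induced_rng.2 (hf n)

/-- The map `x ↦ T_n(t) x` from `X_n` to `X`. -/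
noncomputable def stepT (t : ℝ≥0) (n : ℤ) : P.X n →ₗ[ℂ] P.IndLimit :=
  P.toLimit n ∘ₗ ((P.tower n).T t).toLinearMap

theorem stepT_incl (t : ℝ≥0) (n : ℤ) (x : P.X (n + 1)) :
    P.stepT t n (P.incl n x) = P.stepT t (n + 1) x :=
  (congrArg (P.toLimit n) (P.incl_T n t x).symm).trans (P.toLimit_incl n _)

/-- The operator `T(t) : X → X` defined by the operators `T_n(t)`. -/
noncomputable def limitT (t : ℝ≥0) : P.IndLimit →L[ℂ] P.IndLimit where
  toLinearMap := P.limitLift (P.stepT t) (P.stepT_incl t)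
  cont := P.continuous_of_comp_toLimit _ fun n =>
    ((P.continuous_toLimit n).comp ((P.tower n).T t).continuous).congr fun x =>
      (P.limitLift_toLimit (P.stepT t) (P.stepT_incl t) n x).symm

theorem limitT_toLimit (t : ℝ≥0) (n : ℤ) (x : P.X n) :
    P.limitT t (P.toLimit n x) = P.toLimit n ((P.tower n).T t x) :=
  P.limitLift_toLimit (P.stepT t) (P.stepT_incl t) n x

/-- The map `x ↦ A_n⁻¹ x` from `X_n` to `X`. -/
noncomputable def stepAinv (n : ℤ) : P.X n →ₗ[ℂ] P.IndLimit :=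
  P.toLimit (n + 1) ∘ₗ P.Ainv n

theorem stepAinv_incl (n : ℤ) (x : P.X (n + 1)) :
    P.stepAinv n (P.incl n x) = P.stepAinv (n + 1) x :=
  (congrArg (P.toLimit (n + 1)) (P.incl_Ainv n x).symm).trans (P.toLimit_incl (n + 1) _)

/-- The operator `A⁻¹ : X → X` defined by the operators `A_n⁻¹ : X_n → X_{n+1}`. -/
noncomputable def limitAinv : P.IndLimit →L[ℂ] P.IndLimit where
  toLinearMap := P.limitLift P.stepAinv P.stepAinv_incl
  cont := P.continuous_of_comp_toLimit _ fun n =>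
    ((P.continuous_toLimit (n + 1)).comp (P.continuous_Ainv n)).congr fun x =>
      (P.limitLift_toLimit P.stepAinv P.stepAinv_incl n x).symm

theorem limitAinv_toLimit (n : ℤ) (x : P.X n) :
    P.limitAinv (P.toLimit n x) = P.toLimit (n + 1) (P.Ainv n x) :=
  P.limitLift_toLimit P.stepAinv P.stepAinv_incl n x

/-- `X_m = X_n` for equal indices. -/
noncomputable def castX {m n : ℤ} (h : m = n) : P.X m →ₗ[ℂ] P.X n := h ▸ LinearMap.id

/-- The map `x ↦ A_{n-1} x` from `X_n` to `X`. -/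
noncomputable def stepA (n : ℤ) : P.X n →ₗ[ℂ] P.IndLimit :=
  P.toLimit (n - 1) ∘ₗ P.A (n - 1) ∘ₗ P.castX (sub_add_cancel n 1).symm

theorem stepA_succ (n : ℤ) (x : P.X (n + 1)) :
    P.stepA (n + 1) x = P.toLimit n (P.A n x) := by
  have key : ∀ (k : ℤ) (h : n + 1 = k + 1), P.toLimit k (P.A k (P.castX h x)) =
      P.toLimit n (P.A n x) := by
    intro k h
    obtain rfl : n = k := by omega
    rfl
  exact key (n + 1 - 1) _

theorem stepA_incl (n : ℤ) (x : P.X (n + 1)) :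
    P.stepA n (P.incl n x) = P.stepA (n + 1) x := by
  obtain ⟨m, rfl⟩ : ∃ m, n = m + 1 := ⟨n - 1, by omega⟩
  rw [stepA_succ, stepA_succ, ← incl_A, toLimit_incl]

theorem continuous_stepA (n : ℤ) : Continuous (P.stepA n) := by
  obtain ⟨m, rfl⟩ : ∃ m, n = m + 1 := ⟨n - 1, by omega⟩
  exact ((P.continuous_toLimit m).comp (P.continuous_A m)).congr fun x => (P.stepA_succ m x).symm

/-- The operator `A : X → X` defined by the operators `A_n : X_{n+1} → X_n`. -/
noncomputable def limitA : P.IndLimit →L[ℂ] P.IndLimit where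
  toLinearMap := P.limitLift P.stepA P.stepA_incl
  cont := P.continuous_of_comp_toLimit _ fun n =>
    (P.continuous_stepA n).congr fun x =>
      (P.limitLift_toLimit P.stepA P.stepA_incl n x).symm

theorem limitA_toLimit (n : ℤ) (x : P.X (n + 1)) :
    P.limitA (P.toLimit (n + 1) x) = P.toLimit n (P.A n x) :=
  (P.limitLift_toLimit P.stepA P.stepA_incl (n + 1) x).trans (P.stepA_succ n x)

end InductiveLimit

section UniversalExtrapolation

variable (P : InvertibleSemigroup.{u})

/-- The universal extrapolation space `X_{-∞}`: the completion of the inductive limit. -/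
abbrev ExtrapolationSpace : Type u := Completion P.IndLimit

/-- The operator `T_{-∞}(t)`: the continuous extension of `T(t)` to the completion. -/
noncomputable def extrapolationT (t : ℝ≥0) : P.ExtrapolationSpace →L[ℂ] P.ExtrapolationSpace :=
  (P.limitT t).completion

/-- The operator `A_{-∞}`: the continuous extension of `A` to the completion. -/
noncomputable def extrapolationA : P.ExtrapolationSpace →L[ℂ] P.ExtrapolationSpace :=
  P.limitA.completion

end UniversalExtrapolation

end InvertibleSemigroup

/-! ### Equicontinuous families and completions. -/

section Equicontinuity

/-! On the union `X` the operator `A` is defined everywhere, because `X_{n+1} = D(A_n)` and every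
element of `X` lies in some `X_{n+1}`. It is continuous because the topology is the finest
admissible one. The proof turns this continuity of `A` into uniform bounds for the difference
quotients, which then survive completion.

The isomorphisms `A_n : X_{n+1} → X_n` conjugate `T_{n+1}` to `T_n`, so one exponent ω serves the
whole tower (`exists_equicontinuous_tower`). For a continuous seminorm p on `X`, the supremum over t
of p(e^{ωt}T(t)x) is finite and continuous on every step, hence continuous on `X`. This makes
e^{ωt}T(t) equicontinuous on `X` (`exists_equicontinuous_expLimitT`).

If a continuous seminorm q dominates p ∘ T(s) for all s ≤ 1, then splitting [0, t] into equal parts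
and telescoping gives p(T(t)x - x) ≤ t q(Ax) for 0 < t ≤ 1 (`HasGeneratorValue.seminorm_sub_le`); no
vector-valued integral is needed. Since q ∘ A is continuous, the difference quotients are
equicontinuous on `X`, where they converge to Ax.

Equicontinuity extends to the completion, and an equicontinuous family that converges on a dense
subspace to a continuous map converges everywhere. This gives strong continuity of the extended
semigroup, and it shows that its generator is `A_{-∞}` with domain the whole of `X_{-∞}`. The two
identities between `A` and its inverse on `X` extend by density. -/

/-- The continuous extensions of an equicontinuous family of operators to the completions are
equicontinuous. -/
theorem ContinuousLinearMap.equicontinuous_completion {ι : Type*} {E F : Type*}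
    [AddCommGroup E] [Module ℂ E] [UniformSpace E] [IsUniformAddGroup E]
    [UniformContinuousConstSMul ℂ E] [AddCommGroup F] [Module ℂ F] [UniformSpace F]
    [IsUniformAddGroup F] [UniformContinuousConstSMul ℂ F] (f : ι → E →L[ℂ] F)
    (hf : Equicontinuous fun i => (f i : E → F)) :
    Equicontinuous fun i => ((f i).completion : Completion E → Completion F) := by
  refine equicontinuous_of_equicontinuousAt_zero (fun i => (f i).completion) ?_
  intro U hU
  have hU' : {y : Completion F | ((0 : Completion F), y) ∈ U} ∈ 𝓝 (0 : Completion F) :=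
    UniformSpace.ball_mem_nhds _ hU
  -- A closed neighbourhood is chosen so that membership in `V`, once known on the image of `E`,
  -- passes to closures.
  obtain ⟨V, hV, hVc, hVU⟩ := exists_mem_nhds_isClosed_subset hU'
  have hV' : {y : F | ((y : F) : Completion F) ∈ V} ∈ 𝓝 (0 : F) := by
    refine (Completion.continuous_coe F).continuousAt.preimage_mem_nhds ?_
    rwa [Completion.coe_zero]
  rw [nhds_eq_comap_uniformity, mem_comap] at hV'
  obtain ⟨W, hW, hWV⟩ := hV'
  have h1 : {x : E | ∀ i, ((f i 0 : F), f i x) ∈ W} ∈ 𝓝 (0 : E) := hf 0 W hW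
  have h2 := (Completion.isDenseInducing_coe (α := E)).closure_image_mem_nhds h1
  rw [Completion.coe_zero] at h2
  filter_upwards [h2] with x hx i
  simp only [Function.comp_apply, map_zero]
  refine hVU ?_
  have hcl : IsClosed ((f i).completion ⁻¹' V) := hVc.preimage (f i).completion.continuous
  refine closure_minimal ?_ hcl hx
  rintro _ ⟨y, hy, rfl⟩
  rw [Set.mem_preimage, ContinuousLinearMap.completion_apply_coe]
  refine hWV ?_
  have := hy i
  rwa [map_zero] at this

/-- A family of maps on a completion that is equicontinuous along a filter converges pointwise to a
continuous map as soon as it does so on the dense subspace. -/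
theorem UniformSpace.Completion.tendsto_of_equicontinuous {ι E Y : Type*} [UniformSpace E]
    [UniformSpace Y] {l : Filter ι} {s : Set ι} (hs : s ∈ l) {F : ι → Completion E → Y}
    {f : Completion E → Y} (hF : Equicontinuous fun i : s => F i) (hf : Continuous f)
    (h : ∀ x : E, Tendsto (fun i => F i x) l (𝓝 (f x))) (x : Completion E) :
    Tendsto (fun i => F i x) l (𝓝 (f x)) := by
  -- Equicontinuity is available only for indices in `s`, so the limit is taken along the trace of
  -- `l` on `s`. There the set of points of convergence is closed. As `s ∈ l`, the trace has the
  -- same limits as `l`.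
  have key : ∀ x, Tendsto (fun i : s => F i x) (Filter.comap (↑) l) (𝓝 (f x)) := fun x =>
    Completion.induction_on x (hF.isClosed_setOfPred_tendsto hf)
      fun y => (h y).comp tendsto_comap
  have h2 := tendsto_map'_iff.2 (show Tendsto ((fun i => F i x) ∘ ((↑) : s → ι)) _ _ from key x)
  rwa [map_comap_of_mem (by rwa [Subtype.range_coe])] at h2

end Equicontinuity

/-! ### A bound for difference quotients by telescoping. -/

section Semigroups

/-- A telescoping bound: if the operators `T(s)` with `s ≤ 1` are dominated by `q` with respect to
`p`, then the difference quotients of `T` at `x` are dominated by the value of `q` at the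
generator. -/
theorem HasGeneratorValue.seminorm_sub_le {E : Type u} [AddCommGroup E] [Module ℂ E]
    [TopologicalSpace E] {T : ℝ≥0 → E →L[ℂ] E} (h0 : T 0 = ContinuousLinearMap.id ℂ E)
    (hadd : ∀ t s : ℝ≥0, T (t + s) = (T t).comp (T s)) {p q : Seminorm ℂ E} (hq : Continuous q)
    (hpq : ∀ s ≤ 1, ∀ x, p (T s x) ≤ q x) {x y : E} (h : HasGeneratorValue T x y)
    {t : ℝ≥0} (ht0 : 0 < t) (ht : t ≤ 1) : p (T t x - x) ≤ t * q y := by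
  have tele : ∀ (s : ℝ≥0) (N : ℕ), N * s ≤ 1 →
      p (T (N * s) x - x) ≤ N * q (T s x - x) := by
    intro s N
    induction N with
    | zero => intro _; simp [h0]
    | succ k ih =>
      intro hk
      have hks : (k : ℝ≥0) * s ≤ 1 := le_trans (by gcongr; simp) hk
      have e : T ((k + 1 : ℕ) * s) x - x = T (k * s) (T s x - x) + (T (k * s) x - x) := by
        rw [Nat.cast_succ, add_mul, one_mul, hadd, ContinuousLinearMap.comp_apply, map_sub]
        abel
      rw [e]
      refine (map_add_le_add p _ _).trans ?_
      have h1 := hpq _ hks (T s x - x)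
      have h2 := ih hks
      push_cast
      linarith
  -- The step length is t/(N+1) rather than t/N, so that it is positive for every N.
  have hlim : Tendsto (fun N : ℕ => t / ((N : ℝ≥0) + 1)) atTop (𝓝[>] 0) := by
    refine tendsto_nhdsWithin_iff.2 ⟨?_, Eventually.of_forall fun N => ?_⟩
    · have := (tendsto_one_div_add_atTop_nhds_zero_nat (𝕜 := ℝ)).const_mul (t : ℝ)
      rw [← NNReal.tendsto_coe]
      simpa [div_eq_mul_inv] using this
    · exact div_pos ht0 (by positivity)
  -- With s = t/(N+1), the telescoped bound (N+1) q(T(s)x - x) equals t q(s⁻¹(T(s)x - x)), which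
  -- tends to t q(y).
  have hlim2 := ((hq.tendsto y).comp (h.comp hlim)).const_mul (t : ℝ)
  refine ge_of_tendsto' hlim2 fun N => ?_
  have hN : ((N + 1 : ℕ) : ℝ≥0) * (t / ((N : ℝ≥0) + 1)) = t := by
    push_cast
    field_simp
  have h1 := tele (t / ((N : ℝ≥0) + 1)) (N + 1) (by rw [hN]; exact ht)
  rw [hN] at h1
  refine h1.trans (le_of_eq ?_)
  simp only [Function.comp_apply, map_smul_eq_mul, norm_inv, Complex.norm_real, NNReal.coe_div,
    NNReal.coe_add, NNReal.coe_natCast, NNReal.coe_one]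
  have ht' : (0 : ℝ) < t := ht0
  rw [Real.norm_of_nonneg (by positivity)]
  push_cast
  field_simp

end Semigroups

/-! ### Uniform estimates along the tower and seminorms on its union. -/

namespace InvertibleSemigroup

variable (P : InvertibleSemigroup.{u})

/-- `T_n(t)` is continuous and commutes with the difference quotients of `T_n`, hence with their
limit. Thus `A_n` intertwines consecutive semigroups of the tower. -/
theorem A_T (n : ℤ) (t : ℝ≥0) (x : P.X (n + 1)) :
    P.A n ((P.tower (n + 1)).T t x) = (P.tower n).T t (P.A n x) := by
  refine (P.A_spec n _).unique ?_
  rw [incl_T]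
  exact (P.A_spec n x).map _ fun s y => (P.tower n).T_comm t s y

theorem isUniformInducing_A (n : ℤ) : IsUniformInducing (P.A n) := by
  obtain ⟨B, hB⟩ := P.exists_A_eq n
  rw [show ⇑(P.A n) = B from funext hB]
  exact B.isUniformEmbedding.isUniformInducing

/-- `A_n` is a linear uniform isomorphism that conjugates one family to the other, so the exponent
does not change. Both directions are needed to reach all integers from index 0. -/
theorem equicontinuous_tower_succ_iff (ω : ℝ) (n : ℤ) :
    (Equicontinuous fun (t : ℝ≥0) (x : P.X (n + 1)) =>
      ((Real.exp (ω * t) : ℝ) : ℂ) • (P.tower (n + 1)).T t x) ↔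
    Equicontinuous fun (t : ℝ≥0) (x : P.X n) =>
      ((Real.exp (ω * t) : ℝ) : ℂ) • (P.tower n).T t x := by
  have hA := P.isUniformInducing_A n
  have key : ∀ x : P.X (n + 1), EquicontinuousAt (fun (t : ℝ≥0) (x : P.X (n + 1)) =>
      ((Real.exp (ω * t) : ℝ) : ℂ) • (P.tower (n + 1)).T t x) x ↔
      EquicontinuousAt (fun (t : ℝ≥0) (x : P.X n) =>
      ((Real.exp (ω * t) : ℝ) : ℂ) • (P.tower n).T t x) (P.A n x) := by
    intro x
    rw [hA.equicontinuousAt_iff]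
    have hnhds : 𝓝 (P.A n x) = map (P.A n) (𝓝 x) := by
      obtain ⟨B, hB⟩ := P.exists_A_eq n
      rw [show ⇑(P.A n) = B from funext hB]
      exact (B.toHomeomorph.map_nhds_eq x).symm
    unfold EquicontinuousAt
    rw [hnhds]
    simp only [eventually_map, Function.comp_apply, map_smul, A_T]
  refine ⟨fun h y => ?_, fun h x => (key x).2 (h _)⟩
  obtain ⟨x, rfl⟩ := (P.A_bijective n).2 y
  exact (key x).1 (h x)

/-- The semigroups of the Sobolev tower are exponentially equicontinuous with a common
exponent. -/
theorem exists_equicontinuous_tower : ∃ ω : ℝ, ∀ n : ℤ,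
    Equicontinuous fun (t : ℝ≥0) (x : P.X n) =>
      ((Real.exp (ω * t) : ℝ) : ℂ) • (P.tower n).T t x := by
  obtain ⟨ω, hω⟩ := P.isSemigroup.exp_equicontinuous
  refine ⟨ω, fun n => ?_⟩
  induction n using Int.induction_on with
  | zero => exact hω
  | succ n ih => exact (P.equicontinuous_tower_succ_iff ω n).2 ih
  | pred n ih =>
    refine (P.equicontinuous_tower_succ_iff ω _).1 ?_
    rwa [sub_add_cancel]

theorem toLimit_mem_range_of_le {m n : ℤ} (h : m ≤ n) (x : P.X n) :
    ∃ y : P.X m, P.toLimit m y = P.toLimit n x := by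
  induction n, h using Int.leInduction with
  | base => exact ⟨x, rfl⟩
  | succ n _ ih =>
    obtain ⟨y, hy⟩ := ih (P.incl n x)
    exact ⟨y, hy.trans (P.toLimit_incl n x)⟩

/-- The spaces grow as the index decreases, so finitely many components of a direct sum can be moved
into the step of smallest index and added there. -/
theorem exists_toLimit (x : P.IndLimit) : ∃ (n : ℤ) (y : P.X n), P.toLimit n y = x := by
  obtain ⟨z, rfl⟩ := P.limitRel.mkQ_surjective x
  induction z using DirectSum.induction_on with
  | zero => exact ⟨0, 0, (map_zero _).trans (map_zero P.limitRel.mkQ).symm⟩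
  | of n y => exact ⟨n, y, rfl⟩
  | add a b ha hb =>
    obtain ⟨m, y, hy⟩ := ha
    obtain ⟨n, z, hz⟩ := hb
    obtain ⟨y', hy'⟩ := P.toLimit_mem_range_of_le (min_le_left m n) y
    obtain ⟨z', hz'⟩ := P.toLimit_mem_range_of_le (min_le_right m n) z
    exact ⟨min m n, y' + z', by
      rw [map_add, hy', hz', hy, hz]
      exact (map_add P.limitRel.mkQ a b).symm⟩

theorem exists_toLimit_succ (x : P.IndLimit) :
    ∃ (n : ℤ) (y : P.X (n + 1)), P.toLimit (n + 1) y = x := by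
  obtain ⟨n, y, rfl⟩ := P.exists_toLimit x
  obtain ⟨m, rfl⟩ : ∃ m, n = m + 1 := ⟨n - 1, by omega⟩
  exact ⟨m, y, rfl⟩

/-- A seminorm on the inductive limit is continuous if its restrictions to the steps are. -/
theorem continuous_seminorm_of_comp_toLimit (p : Seminorm ℂ P.IndLimit)
    (hp : ∀ n, Continuous fun x => p (P.toLimit n x)) : Continuous p := by
  let q : SeminormFamily ℂ P.IndLimit Unit := fun _ => p
  -- The topology generated by p alone is locally convex and makes all inclusions continuous. It
  -- therefore competes in the definition of the limit topology and is coarser than it.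
  let t : TopologicalSpace P.IndLimit := q.moduleFilterBasis.topology
  have hq : @WithSeminorms ℂ P.IndLimit Unit _ _ _ q t := @WithSeminorms.mk _ _ _ _ _ _ _ t rfl
  have ht : t ∈ P.limitTopologies := by
    refine ⟨@WithSeminorms.topologicalAddGroup _ _ _ _ _ _ t _ hq,
      @WithSeminorms.continuousSMul _ _ _ _ _ _ t _ hq,
      @WithSeminorms.toLocallyConvexSpace _ _ _ _ _ _ _ _ _ t q hq, fun n => ?_⟩
    exact WithSeminorms.continuous_of_continuous_comp hq (P.toLimit n) fun _ => hp n
  have h1 : @Continuous _ _ t _ p := @WithSeminorms.continuous_seminorm _ _ _ _ _ _ t _ hq ()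
  exact continuous_le_dom (sInf_le ht) h1

end InvertibleSemigroup

/-! ### The semigroup and its generator on the inductive limit. -/

namespace InvertibleSemigroup

variable (P : InvertibleSemigroup.{u})

/-- The seminorm criteria for equicontinuity require complex seminorms, while local convexity is
given over the reals. The nonnegative elements of ℂ are the nonnegative reals, so the same convex
sets form a basis at zero. -/
instance : PolynormableSpace ℂ P.IndLimit := by
  open scoped ComplexOrder in
  have : ContinuousSMul ℝ P.IndLimit := IsScalarTower.continuousSMul ℂ
  have : LocallyConvexSpace ℂ P.IndLimit :=
    LocallyConvexSpace.ofBasisZero ℂ P.IndLimit _ _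
      (LocallyConvexSpace.convex_basis_zero ℝ P.IndLimit) fun s hs =>
        convex_of_nonneg_surjective_algebraMap _
          (fun z hz => by
            obtain ⟨r, hr, rfl⟩ := RCLike.nonneg_iff_exists_ofReal.mp (show (0 : ℂ) ≤ z from hz)
            exact ⟨r, hr, rfl⟩) hs.2
  exact LocallyConvexSpace.toPolynormableSpace

/-- The operators `e^{ωt} T(t)` on the inductive limit. -/
noncomputable def expLimitT (ω : ℝ) (t : ℝ≥0) : P.IndLimit →L[ℂ] P.IndLimit :=
  ((Real.exp (ω * t) : ℝ) : ℂ) • P.limitT t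

theorem exists_equicontinuous_expLimitT : ∃ ω : ℝ,
    Equicontinuous fun t => (P.expLimitT ω t : P.IndLimit → P.IndLimit) := by
  obtain ⟨ω, hω⟩ := P.exists_equicontinuous_tower
  refine ⟨ω, ?_⟩
  have hw := PolynormableSpace.withSeminorms ℂ P.IndLimit
  let f : ℝ≥0 → P.IndLimit →ₗ[ℂ] P.IndLimit := fun t => (P.expLimitT ω t).toLinearMap
  -- Equicontinuity is restated as follows: for each continuous seminorm p, the seminorms p ∘ f(t)
  -- are bounded above and their supremum is continuous.
  refine ((hw.equicontinuous_TFAE f).out 1 4).2 fun p => ?_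
  let g : ∀ n : ℤ, ℝ≥0 → P.X n →ₗ[ℂ] P.IndLimit := fun n t => f t ∘ₗ P.toLimit n
  have hg : ∀ n, Equicontinuous ((↑) ∘ g n : ℝ≥0 → P.X n → P.IndLimit) := fun n => by
    have h1 : UniformEquicontinuous fun (t : ℝ≥0) (x : P.X n) =>
        ((Real.exp (ω * (t : ℝ)) : ℝ) : ℂ) • (P.tower n).T t x :=
      uniformEquicontinuous_of_equicontinuousAt_zero
        (fun t : ℝ≥0 => ((Real.exp (ω * t) : ℝ) : ℂ) • (P.tower n).T t) (hω n 0)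
    let J : P.X n →L[ℂ] P.IndLimit := ⟨P.toLimit n, P.continuous_toLimit n⟩
    have h2 : UniformEquicontinuous fun (t : ℝ≥0) (x : P.X n) =>
        J (((Real.exp (ω * t) : ℝ) : ℂ) • (P.tower n).T t x) :=
      fun U hU => h1 _ (J.uniformContinuous hU)
    convert h2.equicontinuous using 1
    ext t x
    change ((Real.exp (ω * t) : ℝ) : ℂ) • P.limitT t (P.toLimit n x) = _
    rw [limitT_toLimit, ← map_smul]
    rfl
  have hg2 : ∀ n, BddAbove (Set.range fun t => p.1.comp (g n t)) ∧
      Continuous (⨆ t, ⇑(p.1.comp (g n t))) := fun n => by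
    have h := (hw.equicontinuous_TFAE (g n)).out 1 4
    exact h.1 (hg n) p
  have hbdd : BddAbove (Set.range fun t => p.1.comp (f t)) := by
    rw [Seminorm.bddAbove_range_iff]
    intro x
    obtain ⟨n, y, rfl⟩ := P.exists_toLimit x
    exact Seminorm.bddAbove_range_iff.1 (hg2 n).1 y
  refine ⟨hbdd, ?_⟩
  -- Restricted to `X_n`, the supremum is the one formed with `g n`, which is continuous by `hg2`.
  have hc := P.continuous_seminorm_of_comp_toLimit (⨆ t, p.1.comp (f t)) fun n => by
    refine (Seminorm.coe_iSup_eq (hg2 n).1 ▸ (hg2 n).2).congr fun x => ?_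
    rw [Seminorm.iSup_apply (hg2 n).1, Seminorm.iSup_apply hbdd]
    rfl
  rwa [Seminorm.coe_iSup_eq hbdd] at hc

/-- The operators `T(t)`, `t ≤ b`, are dominated by a continuous seminorm. -/
theorem exists_seminorm_limitT_le (b : ℝ≥0) (p : Seminorm ℂ P.IndLimit) (hp : Continuous p) :
    ∃ q : Seminorm ℂ P.IndLimit, Continuous q ∧ ∀ t ≤ b, ∀ x, p (P.limitT t x) ≤ q x := by
  obtain ⟨ω, hω⟩ := P.exists_equicontinuous_expLimitT
  have hw := PolynormableSpace.withSeminorms ℂ P.IndLimit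
  let f : ℝ≥0 → P.IndLimit →ₗ[ℂ] P.IndLimit := fun t => (P.expLimitT ω t).toLinearMap
  have hf := (hw.equicontinuous_TFAE f).out 1 3
  obtain ⟨q, hq, hpq⟩ := hf.1 hω ⟨p, hp⟩
  -- For 0 ≤ t ≤ b one has e^{-ωt} ≤ e^{|ω|b}, whatever the sign of ω; this removes the exponential
  -- weight.
  let c : ℝ≥0 := ⟨Real.exp (|ω| * b), (Real.exp_pos _).le⟩
  refine ⟨c • q, hq.const_smul c, fun t ht x => ?_⟩
  have h1 : p (((Real.exp (ω * t) : ℝ) : ℂ) • P.limitT t x) ≤ q x := hpq t x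
  rw [map_smul_eq_mul, Complex.norm_real, Real.norm_of_nonneg (Real.exp_pos _).le] at h1
  have h2 : 1 ≤ Real.exp (|ω| * b) * Real.exp (ω * t) := by
    rw [← Real.exp_add]
    refine Real.one_le_exp ?_
    have h3 : |ω * t| ≤ |ω| * b := by
      rw [abs_mul, abs_of_nonneg t.coe_nonneg]
      exact mul_le_mul_of_nonneg_left ht (abs_nonneg _)
    linarith [neg_abs_le (ω * t)]
  change p (P.limitT t x) ≤ Real.exp (|ω| * b) * q x
  calc p (P.limitT t x) ≤ Real.exp (|ω| * b) * Real.exp (ω * t) * p (P.limitT t x) :=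
        le_mul_of_one_le_left (apply_nonneg p _) h2
    _ ≤ Real.exp (|ω| * b) * q x := by
        rw [mul_assoc]
        exact mul_le_mul_of_nonneg_left h1 (Real.exp_pos _).le

/-- The semigroup on the inductive limit is locally equicontinuous. -/
theorem equicontinuous_limitT_Iic (b : ℝ≥0) :
    Equicontinuous fun t : Set.Iic b => (P.limitT t : P.IndLimit → P.IndLimit) := by
  have hw := PolynormableSpace.withSeminorms ℂ P.IndLimit
  let f : Set.Iic b → P.IndLimit →ₗ[ℂ] P.IndLimit := fun t => (P.limitT t).toLinearMap
  refine ((hw.equicontinuous_TFAE f).out 1 3).2 ?_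
  rintro ⟨p, hp⟩
  obtain ⟨q, hq, hpq⟩ := P.exists_seminorm_limitT_le b p hp
  exact ⟨q, hq, fun t x => hpq t t.2 x⟩

theorem limitT_zero : P.limitT 0 = ContinuousLinearMap.id ℂ P.IndLimit := by
  ext x
  obtain ⟨n, y, rfl⟩ := P.exists_toLimit x
  rw [limitT_toLimit, (P.tower n).isSemigroup.map_zero]
  rfl

theorem limitT_add (t s : ℝ≥0) : P.limitT (t + s) = (P.limitT t).comp (P.limitT s) := by
  ext x
  obtain ⟨n, y, rfl⟩ := P.exists_toLimit x
  rw [ContinuousLinearMap.comp_apply, limitT_toLimit, limitT_toLimit, limitT_toLimit,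
    (P.tower n).isSemigroup.map_add]
  rfl

theorem continuous_limitT_apply (x : P.IndLimit) : Continuous fun t => P.limitT t x := by
  obtain ⟨n, y, rfl⟩ := P.exists_toLimit x
  simp_rw [limitT_toLimit]
  exact (P.continuous_toLimit n).comp ((P.tower n).isSemigroup.strongly_continuous y)

/-- Every element of `X` comes from some `X_{n+1} = D(A_n)`. The difference quotients converge in
`X_n`, and the inclusion into `X` preserves the limit. -/
theorem hasGeneratorValue_limitA (x : P.IndLimit) :
    HasGeneratorValue P.limitT x (P.limitA x) := by
  obtain ⟨n, y, rfl⟩ := P.exists_toLimit_succ x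
  rw [limitA_toLimit, ← toLimit_incl]
  exact (P.A_spec n y).map (⟨P.toLimit n, P.continuous_toLimit n⟩ : P.X n →L[ℂ] P.IndLimit)
    fun t z => (P.limitT_toLimit t n z).symm

theorem limitAinv_limitA (x : P.IndLimit) : P.limitAinv (P.limitA x) = x := by
  obtain ⟨n, y, rfl⟩ := P.exists_toLimit_succ x
  rw [limitA_toLimit, limitAinv_toLimit, Ainv_A]

theorem limitA_limitAinv (x : P.IndLimit) : P.limitA (P.limitAinv x) = x := by
  obtain ⟨n, y, rfl⟩ := P.exists_toLimit x
  rw [limitAinv_toLimit, limitA_toLimit, A_Ainv]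

/-! ### Passage to the extrapolation space. -/

theorem isExpEquicontSemigroup_extrapolationT : IsExpEquicontSemigroup P.extrapolationT := by
  obtain ⟨ω, hω⟩ := P.exists_equicontinuous_expLimitT
  have hexp : Equicontinuous fun (t : ℝ≥0) (x : P.ExtrapolationSpace) =>
      ((Real.exp (ω * t) : ℝ) : ℂ) • P.extrapolationT t x := by
    convert ContinuousLinearMap.equicontinuous_completion _ hω using 1
    ext t x
    induction x using Completion.induction_on with
    | hp =>
      exact isClosed_eq (((Real.exp (ω * t) : ℝ) : ℂ) • P.extrapolationT t).continuous
        (P.expLimitT ω t).completion.continuous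
    | ih x =>
      rw [extrapolationT, ContinuousLinearMap.completion_apply_coe,
        ContinuousLinearMap.completion_apply_coe, ← Completion.coe_smul]
      rfl
  refine ⟨?_, fun t s => ?_, fun x => ?_, ω, hexp⟩
  · ext x
    induction x using Completion.induction_on with
    | hp => exact isClosed_eq (P.extrapolationT 0).continuous continuous_id
    | ih x =>
      rw [extrapolationT, ContinuousLinearMap.completion_apply_coe, limitT_zero]
      rfl
  · ext x
    induction x using Completion.induction_on with
    | hp =>
      exact isClosed_eq (P.extrapolationT _).continuous
        ((P.extrapolationT t).comp (P.extrapolationT s)).continuous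
    | ih x =>
      rw [ContinuousLinearMap.comp_apply]
      simp only [extrapolationT, ContinuousLinearMap.completion_apply_coe, limitT_add,
        ContinuousLinearMap.comp_apply]
  · refine continuous_iff_continuousAt.2 fun t => ?_
    -- Continuity at t concerns only times near t. The operators with times up to t + 1 are
    -- equicontinuous without any exponential weight.
    refine Completion.tendsto_of_equicontinuous (F := fun t x => P.extrapolationT t x)
      (Iic_mem_nhds (lt_add_one t))
      (ContinuousLinearMap.equicontinuous_completion _ (P.equicontinuous_limitT_Iic (t + 1)))
      (P.extrapolationT t).continuous (fun x => ?_) x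
    simp only [extrapolationT, ContinuousLinearMap.completion_apply_coe]
    exact ((Completion.continuous_coe _).comp (P.continuous_limitT_apply x)).tendsto t

/-- The difference quotients of `T` are equicontinuous for `0 < t ≤ 1`. -/
theorem equicontinuous_limitT_quotient : Equicontinuous fun t : Set.Ioc (0 : ℝ≥0) 1 =>
    (((((t : ℝ≥0) : ℝ) : ℂ)⁻¹ • (P.limitT t - ContinuousLinearMap.id ℂ P.IndLimit) :
      P.IndLimit →L[ℂ] P.IndLimit) : P.IndLimit → P.IndLimit) := by
  have hw := PolynormableSpace.withSeminorms ℂ P.IndLimit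
  let f : Set.Ioc (0 : ℝ≥0) 1 → P.IndLimit →ₗ[ℂ] P.IndLimit := fun t =>
    ((((t : ℝ≥0) : ℝ) : ℂ)⁻¹ • (P.limitT t - ContinuousLinearMap.id ℂ P.IndLimit)).toLinearMap
  refine ((hw.equicontinuous_TFAE f).out 1 3).2 ?_
  rintro ⟨p, hp⟩
  obtain ⟨q, hq, hpq⟩ := P.exists_seminorm_limitT_le 1 p hp
  -- The dominating seminorm q ∘ A is continuous because `A` is continuous on all of `X`; the factor
  -- t of the telescoping bound cancels the denominator.
  refine ⟨q.comp P.limitA.toLinearMap, hq.comp P.limitA.continuous, fun ⟨t, ht0, ht1⟩ x => ?_⟩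
  have h := (P.hasGeneratorValue_limitA x).seminorm_sub_le P.limitT_zero P.limitT_add hq hpq
    ht0 ht1
  change p ((((t : ℝ≥0) : ℝ) : ℂ)⁻¹ • (P.limitT t x - x)) ≤ q (P.limitA x)
  have ht' : (0 : ℝ) < t := ht0
  rw [map_smul_eq_mul, norm_inv, Complex.norm_real, Real.norm_of_nonneg ht'.le]
  exact inv_mul_le_of_le_mul₀ ht'.le (apply_nonneg _ _) h

/-- Every element of `X_{-∞}` lies in the domain of the generator of `T_{-∞}`, with value given by
`A_{-∞}`. -/
theorem hasGeneratorValue_extrapolationA (x : P.ExtrapolationSpace) :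
    HasGeneratorValue P.extrapolationT x (P.extrapolationA x) := by
  have hE := ContinuousLinearMap.equicontinuous_completion _ P.equicontinuous_limitT_quotient
  have hF : Equicontinuous fun (t : Set.Ioc (0 : ℝ≥0) 1) (x : P.ExtrapolationSpace) =>
      (((t : ℝ≥0) : ℝ) : ℂ)⁻¹ • (P.extrapolationT t x - x) := by
    convert hE using 1
    ext t x
    induction x using Completion.induction_on with
    | hp =>
      exact isClosed_eq ((((t : ℝ≥0) : ℝ) : ℂ)⁻¹ •
        (P.extrapolationT t - ContinuousLinearMap.id ℂ P.ExtrapolationSpace)).continuous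
        (ContinuousLinearMap.continuous _)
    | ih x =>
      rw [extrapolationT, ContinuousLinearMap.completion_apply_coe,
        ContinuousLinearMap.completion_apply_coe, ← Completion.coe_sub, ← Completion.coe_smul]
      rfl
  -- The interval (0, 1] belongs to the filter of times decreasing to 0, so convergence on the dense
  -- image of `X` to the continuous map `A_{-∞}` extends to every x.
  refine Completion.tendsto_of_equicontinuous
    (F := fun (t : ℝ≥0) x => ((t : ℝ) : ℂ)⁻¹ • (P.extrapolationT t x - x))
    (Ioc_mem_nhdsGT one_pos) hF P.extrapolationA.continuous (fun y => ?_) x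
  have h := (P.hasGeneratorValue_limitA y).map (S := P.extrapolationT)
    (⟨⟨⟨((↑) : P.IndLimit → P.ExtrapolationSpace), Completion.coe_add⟩,
      Completion.coe_smul⟩, Completion.continuous_coe _⟩ : P.IndLimit →L[ℂ] P.ExtrapolationSpace)
    fun t z => (ContinuousLinearMap.completion_apply_coe (P.limitT t) z).symm
  rw [extrapolationA, ContinuousLinearMap.completion_apply_coe]
  exact h

/-- `A_{-∞}` as a topological isomorphism. -/
noncomputable def extrapolationEquiv : P.ExtrapolationSpace ≃L[ℂ] P.ExtrapolationSpace :=
  ContinuousLinearEquiv.equivOfInverse P.extrapolationA P.limitAinv.completion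
    (fun x => by
      induction x using Completion.induction_on with
      | hp =>
        exact isClosed_eq (P.limitAinv.completion.comp P.extrapolationA).continuous continuous_id
      | ih x =>
        simp only [extrapolationA, ContinuousLinearMap.completion_apply_coe, limitAinv_limitA])
    (fun x => by
      induction x using Completion.induction_on with
      | hp =>
        exact isClosed_eq (P.extrapolationA.comp P.limitAinv.completion).continuous continuous_id
      | ih x =>
        simp only [extrapolationA, ContinuousLinearMap.completion_apply_coe, limitA_limitAinv])

end InvertibleSemigroup

theorem theorem2 (P : InvertibleSemigroup.{u}) [T2Space P.IndLimit] :
    (IsExpEquicontSemigroup P.extrapolationT ∧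
      (∀ x : P.IndLimit, (x : P.ExtrapolationSpace) ∈ (generator P.extrapolationT).domain) ∧
      (∀ x : (generator P.extrapolationT).domain,
        generator P.extrapolationT x = P.extrapolationA x) ∧
      Continuous (fun x : (generator P.extrapolationT).domain => generator P.extrapolationT x)) ∧
    (BarrelledSpace ℂ P.ExtrapolationSpace →
      (generator P.extrapolationT).domain = ⊤ ∧
      generator P.extrapolationT = P.extrapolationA.toLinearMap.toPMap ⊤) ∧
    (∃ e : P.ExtrapolationSpace ≃L[ℂ] P.ExtrapolationSpace,
      (∀ x, e x = P.extrapolationA x) ∧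
      (∀ x : P.IndLimit, e.symm x = (P.limitAinv x : P.ExtrapolationSpace)) ∧
      ∀ f : P.ExtrapolationSpace → P.ExtrapolationSpace, Continuous f →
        (∀ x : P.IndLimit, f x = (P.limitAinv x : P.ExtrapolationSpace)) → f = e.symm) := by
  have hgen : ∀ x : (generator P.extrapolationT).domain,
      generator P.extrapolationT x = P.extrapolationA x := fun x =>
    generator_eq (P.hasGeneratorValue_extrapolationA x)
  have hdom : (generator P.extrapolationT).domain = ⊤ :=
    (Submodule.eq_top_iff').2 fun x => ⟨_, P.hasGeneratorValue_extrapolationA x⟩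
  have hsymm : ∀ x : P.IndLimit,
      P.extrapolationEquiv.symm x = (P.limitAinv x : P.ExtrapolationSpace) :=
    P.limitAinv.completion_apply_coe
  refine ⟨⟨P.isExpEquicontSemigroup_extrapolationT,
    fun x => ⟨_, P.hasGeneratorValue_extrapolationA x⟩, hgen, ?_⟩, fun _ => ⟨hdom, ?_⟩,
    P.extrapolationEquiv, fun _ => rfl, hsymm, fun f hf hfx => ?_⟩
  · exact (P.extrapolationA.continuous.comp continuous_subtype_val).congr fun x => (hgen x).symm
  · refine LinearPMap.ext hdom fun x hx _ => ?_
    exact hgen ⟨x, hx⟩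
  -- Continuity alone gives uniqueness, without linearity of f: the image of `X` is dense and the
  -- completion is Hausdorff.
  · exact Completion.ext hf P.extrapolationEquiv.symm.continuous fun x =>
      (hfx x).trans (hsymm x).symm
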